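/- Let $V$ be a finite-dimensional complex vector space, $\Lambda\subset V$ a lattice and $T=V/\Lambda$. Let $V^\vee$ be the complex vector space of antilinear forms $w\colon V\to\mathbb C$, with the pairing $\langle w,z\rangle=\operatorname{Im}(w(z))$, let $\Lambda^\vee=\{\lambda\in V^\vee:\langle\lambda,\Lambda\rangle\subset\mathbb Z\}$, and let $T^\vee=V^\vee/\Lambda^\vee$ be the dual torus. Let $E\colon\Lambda\times\Lambda\to\mathbb Z$ be a polarization, that is, a non-degenerate antisymmetric bilinear form whose real bilinear extension to $V$ satisfies $E(iv,iw)=E(v,w)$ for all $v,w$ and $-E(iv,v)>0$ for $v\neq 0$. Put $H(v,w)=-E(iv,w)-iE(v,w)$ and let $\lambda_E\colon T\to T^\vee$ be the isogeny induced by $V\to V^\vee$, $v\mapsto H(v,-)$. Let $(a,b)=(a_1,\dots,a_g,b_1,\dots,b_g)$ be an integral basis of $\Lambda$ such that $a$ is a complex basis of $V$ and such that the matrix of $E$ on $(a,b)$ is $\begin{pmatrix}0&\Delta\\-\Delta&0\end{pmatrix}$ with $\Delta$ an integral diagonal matrix. The period matrix $\Omega\in M_g(\mathbb C)$ is defined by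 $b=a\Omega$. Let $(a^*,b^*)$ be the basis of $\Lambda^\vee$ dual to $(a,b)$. Vectors $z\in V$ are written as columns in the basis $a$, and $w\in V^\vee$ as rows in the complex basis $b^*$. For $\mu=\mu_1+\Omega\mu_2\in\Lambda$ and $\lambda=-\lambda_1\Omega+\lambda_2\in\Lambda^\vee$, the $\lambda_i$ and $\mu_i$ are integral row and column vectors. Let $\mathcal P$ be the Poincaré bundle on $T\times T^\vee$, the quotient of $V\times V^\vee\times\mathbb C$ by the action of $\Lambda\times\Lambda^\vee$ given by $$(\mu,\lambda)\cdot(z,w,s)=\bigl(z+\mu,\;w+\lambda,\;s\exp(\pi((w+\lambda)(\mu)+\overline{\lambda(z)}))\bigr),$$ with its rigidification $\mathcal P|_{(0,0)}\cong\mathbb C$, $[(0,0),s]\mapsto s$. Then: 1. $\operatorname{Im}\Omega$ is invertible. 2. $\mathcal P$ has a unique smooth hermitian metric $\|\cdot\|$ whose curvature form is invariant under translations of $T\times T^\vee$ and with $\|1\|=1$ at $(0,0)$ (the invariant metric). 3. The pullback of $\mathcal P$ to $V\times V^\vee$ has a unique nowhere vanishing holomorphic frame $e$ with $e(0,0)=1$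 and $$e(z,w)=\exp\bigl(2\pi i((w+\lambda)\mu_2-\lambda_1z)\bigr)\,e(z+\mu,w+\lambda)\qquad(\mu\in\Lambda,\ \lambda\in\Lambda^\vee),$$ an equality of points of the total space of $\mathcal P$. 4. In the frame $z\mapsto e(z,\lambda_E(z))$ of the pullback to $V$ of $(\mathrm{id},\lambda_E)^*\mathcal P$, the metric induced by $\|\cdot\|$ is $$\|(z,s)\|^2=\|s\cdot e(z,\lambda_E(z))\|^2=|s|^2\exp\bigl(-4\pi\operatorname{Im}(z)^t\,\Delta\,(\operatorname{Im}\Omega)^{-1}\operatorname{Im}(z)\bigr)$$ for all $z\in V$ and $s\in\mathbb C$. -/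

import Mathlib

open scoped ContDiff

noncomputable section

namespace PoincareBundle

/-! ### Antilinear forms, dual lattices and complex tori -/

section Torus

variable {V : Type*} [NormedAddCommGroup V] [NormedSpace ℂ V]

/-- The complex vector space of antilinear forms on `V` (all of them, if `V` is finite
dimensional). -/
abbrev AntiDual (V : Type*) [NormedAddCommGroup V] [NormedSpace ℂ V] : Type _ :=
  V →SL[starRingEnd ℂ] ℂ

/-- The real pairing `⟨w, z⟩ = Im (w z)`. -/
def pairing (w : AntiDual V) (z : V) : ℝ := (w z).im

/-- The dual lattice: the antilinear forms whose pairing with `Λ` is integral. -/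
def dualLattice (Λ : Submodule ℤ V) : Submodule ℤ (AntiDual V) where
  carrier := {w | ∀ μ ∈ Λ, ∃ n : ℤ, pairing w μ = n}
  zero_mem' := fun μ _ => ⟨0, by simp [pairing]⟩
  add_mem' := by
    intro w w' h h' μ hμ
    obtain ⟨n, hn⟩ := h μ hμ
    obtain ⟨n', hn'⟩ := h' μ hμ
    exact ⟨n + n', by simp only [pairing] at hn hn' ⊢; simp [hn, hn']⟩
  smul_mem' := by
    intro c w h μ hμ
    obtain ⟨n, hn⟩ := h μ hμ
    exact ⟨c * n, by simp only [pairing] at hn ⊢; simp [hn]⟩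

/-- The torus `V / Λ`. -/
abbrev Torus (Λ : Submodule ℤ V) : Type _ := V ⧸ Λ

/-- The dual torus. -/
abbrev DualTorus (Λ : Submodule ℤ V) : Type _ := Torus (dualLattice Λ)

end Torus

/-! ### The Poincaré bundle -/

section Poincare

variable {V : Type*} [NormedAddCommGroup V] [NormedSpace ℂ V]

/-- The automorphy factor `exp (π ((w + l) μ + conj (l z)))` of the Poincaré bundle, for the
translation by `(μ, l)` at the point `(z, w)`. -/
def factorA (γ x : V × AntiDual V) : ℂ :=
  Complex.exp (Real.pi * ((x.2 + γ.2) γ.1 + starRingEnd ℂ (γ.2 x.1)))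

/-- The factor is a cocycle on `Λ × Λ^∨`. -/
theorem factorA_add (Λ : Submodule ℤ V) {γ γ' : V × AntiDual V}
    (h : γ.1 ∈ Λ) (h' : γ'.2 ∈ dualLattice Λ) (x : V × AntiDual V) :
    factorA (γ + γ') x = factorA γ' (x + γ) * factorA γ x := by
  obtain ⟨n, hn⟩ := h' γ.1 h
  have e : (γ'.2 γ.1) = starRingEnd ℂ (γ'.2 γ.1) + 2 * (n : ℂ) * Complex.I := by
    apply Complex.ext
    · simp
    · simp only [pairing] at hn
      simp [hn]
      ring
  simp only [factorA, ← Complex.exp_add]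
  rw [Complex.exp_eq_exp_iff_exists_int]
  refine ⟨n, ?_⟩
  simp only [Prod.fst_add, Prod.snd_add, add_apply, map_add]
  linear_combination (Real.pi : ℂ) * e

theorem factorA_zero (x : V × AntiDual V) : factorA 0 x = 1 := by
  simp [factorA]

/-- `(x, s) ∼ (x + γ, a(γ, x) s)` for `γ ∈ Λ × Λ^∨`. -/
def poincareSetoid (Λ : Submodule ℤ V) : Setoid ((V × AntiDual V) × ℂ) where
  r p q := ∃ γ : V × AntiDual V, γ.1 ∈ Λ ∧ γ.2 ∈ dualLattice Λ ∧
    q = (p.1 + γ, factorA γ p.1 * p.2)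
  iseqv := by
    refine ⟨fun p => ⟨0, by simp, by simp, by simp [factorA_zero]⟩, ?_, ?_⟩
    · rintro ⟨x, s⟩ _ ⟨γ, h1, h2, rfl⟩
      refine ⟨-γ, by simpa using h1, by simpa using h2, ?_⟩
      have := factorA_add Λ (γ := γ) (γ' := -γ) h1 (by simpa using h2) x
      rw [add_neg_cancel, factorA_zero] at this
      ext1
      · simp
      · simp only
        rw [← mul_assoc, ← this, one_mul]
    · rintro ⟨x, s⟩ _ _ ⟨γ, h1, h2, rfl⟩ ⟨γ', h1', h2', rfl⟩
      refine ⟨γ + γ', add_mem h1 h1', add_mem h2 h2', ?_⟩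
      have := factorA_add Λ h1 h2' x
      ext1
      · simp [add_assoc]
      · simp only
        rw [this, mul_assoc]

/-- The total space of the Poincaré bundle on `T × T^∨`, the quotient of the trivial line bundle
`(V × V^∨) × ℂ` by `Λ × Λ^∨`. -/
def Poincare (Λ : Submodule ℤ V) : Type _ := Quotient (poincareSetoid Λ)

namespace Poincare

variable {Λ : Submodule ℤ V}

/-- The class `[x, s]`; thus `x ↦ [x, 1]` is a holomorphic frame over `V × V^∨`. -/
def mk (x : V × AntiDual V) (s : ℂ) : Poincare Λ := Quotient.mk (poincareSetoid Λ) (x, s)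

/-- The projection `[(z, w), s] ↦ ([z], [w])`. -/
def proj : Poincare Λ → Torus Λ × DualTorus Λ :=
  Quotient.lift (fun p => (Submodule.Quotient.mk p.1.1, Submodule.Quotient.mk p.1.2)) (by
    rintro ⟨x, s⟩ _ ⟨γ, h1, h2, rfl⟩
    ext1
    · exact (Submodule.Quotient.eq Λ).2 (by simpa using h1)
    · exact (Submodule.Quotient.eq (dualLattice Λ)).2 (by simpa using h2))

/-- Scalar multiplication in the fibres. -/
instance : SMul ℂ (Poincare Λ) where
  smul c := Quotient.map (fun p => (p.1, c * p.2)) (by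
    rintro ⟨x, s⟩ _ ⟨γ, h1, h2, rfl⟩
    exact ⟨γ, h1, h2, by ext1 <;> simp [mul_left_comm]⟩)

theorem proj_mk (x : V × AntiDual V) (s : ℂ) : proj (mk x s : Poincare Λ) =
    (Submodule.Quotient.mk x.1, Submodule.Quotient.mk x.2) := rfl

theorem smul_mk (c : ℂ) (x : V × AntiDual V) (s : ℂ) :
    c • (mk x s : Poincare Λ) = mk x (c * s) := rfl

theorem proj_smul (c : ℂ) (p : Poincare Λ) : proj (c • p) = proj p :=
  Quotient.inductionOn p (fun _ => rfl)

theorem mk_add (x γ : V × AntiDual V) (s : ℂ) (h1 : γ.1 ∈ Λ) (h2 : γ.2 ∈ dualLattice Λ) :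
    (mk (x + γ) (factorA γ x * s) : Poincare Λ) = mk x s :=
  (Quotient.sound (s := poincareSetoid Λ) (a := (x, s)) ⟨γ, h1, h2, rfl⟩).symm

end Poincare

/-! ### Metrics and curvature -/

section Forms

variable {W : Type*} [NormedAddCommGroup W] [NormedSpace ℂ W]

/-- The `(0,1)`-form `∂̄f`, at `x` on the tangent vector `u`. -/
def dbar (f : W → ℝ) (x u : W) : ℂ :=
  (1 / 2) * ((fderiv ℝ f x u : ℂ) + Complex.I * (fderiv ℝ f x (Complex.I • u) : ℂ))

/-- The `(1,1)`-form `∂∂̄f = d(∂̄f)`, at `x` on the tangent vectors `u`, `v`. -/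
def ddbar (f : W → ℝ) (x u v : W) : ℂ :=
  fderiv ℝ (fun y => dbar f y v) x u - fderiv ℝ (fun y => dbar f y u) x v

/-- Smoothness on the real manifold underlying `W`. -/
def IsSmooth (f : W → ℝ) : Prop := ContDiff ℝ ∞ f

end Forms

/-- A smooth hermitian metric on the Poincaré bundle, given by its norm function on the total
space. -/
structure IsMetric {Λ : Submodule ℤ V} (N : Poincare Λ → ℝ) : Prop where
  norm_smul : ∀ (c : ℂ) (p : Poincare Λ), N (c • p) = ‖c‖ * N p
  pos : ∀ x : V × AntiDual V, 0 < N (Poincare.mk x 1)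
  smooth : IsSmooth (fun x : V × AntiDual V => N (Poincare.mk x 1) ^ 2)

/-- The curvature form `-∂∂̄ log ‖e‖²`, lifted to `V × V^∨`, where `e` is the holomorphic frame
`x ↦ [x, 1]`. -/
def curvature {Λ : Submodule ℤ V} (N : Poincare Λ → ℝ) (x u v : V × AntiDual V) : ℂ :=
  -ddbar (fun y : V × AntiDual V => Real.log (N (Poincare.mk y 1) ^ 2)) x u v

/-- The invariant metric of the Poincaré bundle: its curvature form is invariant under all
translations of `T × T^∨`, and under the rigidification `[(0, 0), s] ↦ s` of the fibre at the
origin it satisfies `‖1‖ = 1`. -/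
structure IsInvariantMetric {Λ : Submodule ℤ V} (N : Poincare Λ → ℝ) : Prop
    extends IsMetric N where
  curvature_invariant : ∀ x y u v : V × AntiDual V,
    curvature N (x + y) u v = curvature N x u v
  normalized : N (Poincare.mk 0 1) = 1

end Poincare

/-! ### Integral bases and period matrices -/

section Basis

variable {V : Type*} [NormedAddCommGroup V] [NormedSpace ℂ V]

/-- An integral basis `(a, b)` of `Λ` such that `a` is a complex basis of `V`. -/
structure IntegralBasis (Λ : Submodule ℤ V) (g : ℕ) where
  /-- The basis of the lattice: `Sum.inl i` gives `a_i` and `Sum.inr i` gives `b_i`. -/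
  lat : Module.Basis (Fin g ⊕ Fin g) ℤ Λ
  /-- The complex basis `a`. -/
  cplx : Module.Basis (Fin g) ℂ V
  cplx_eq : ∀ i, cplx i = (lat (Sum.inl i) : V)

/-- The antilinear form with a given imaginary part. -/
def antiOfIm [FiniteDimensional ℂ V] (φ : V →ₗ[ℝ] ℝ) : AntiDual V where
  toFun z := -(φ (Complex.I • z) : ℂ) + Complex.I * (φ z : ℂ)
  map_add' z z' := by simp only [smul_add, map_add]; push_cast; ring
  map_smul' c z := by
    have h : ∀ (c : ℂ) (z : V), φ (c • z) = c.re * φ z + c.im * φ (Complex.I • z) := by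
      intro c z
      have : c • z = c.re • z + c.im • (Complex.I • z) := by
        conv_lhs => rw [← Complex.re_add_im c]
        rw [add_smul, mul_smul, Complex.coe_smul, Complex.coe_smul]
      rw [this, map_add, map_smul, map_smul, smul_eq_mul, smul_eq_mul]
    rw [smul_smul, h c z, h (Complex.I * c) z]
    apply Complex.ext <;> simp
  cont := by
    have : Continuous φ := φ.continuous_of_finiteDimensional
    fun_prop

theorem pairing_antiOfIm [FiniteDimensional ℂ V] (φ : V →ₗ[ℝ] ℝ) (z : V) :
    pairing (antiOfIm φ) z = φ z := by
  change (-(φ (Complex.I • z) : ℂ) + Complex.I * (φ z : ℂ)).im = φ z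
  simp

namespace IntegralBasis

variable {Λ : Submodule ℤ V} {g : ℕ} (B : IntegralBasis Λ g)

/-- The vectors `a_i` of the basis. -/
def a (i : Fin g) : V := B.lat (Sum.inl i)

/-- The vectors `b_i` of the basis. -/
def b (i : Fin g) : V := B.lat (Sum.inr i)

/-- The period matrix `Ω`, determined by `(b_1, …, b_g) = (a_1, …, a_g) Ω`. -/
def periodMatrix : Matrix (Fin g) (Fin g) ℂ := B.cplx.toMatrix B.b

theorem b_eq (j : Fin g) : B.b j = ∑ i, B.periodMatrix i j • B.a i := by
  have := B.cplx.sum_toMatrix_smul_self B.b j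
  simp only [B.cplx_eq] at this
  exact this.symm

/-- The complex coordinates of an antilinear form given by its values on `a`. -/
def evalA : AntiDual V →ₗ[ℂ] (Fin g → ℂ) where
  toFun w i := w (B.a i)
  map_add' _ _ := rfl
  map_smul' _ _ := rfl

theorem evalA_injective : Function.Injective B.evalA := by
  rw [← LinearMap.ker_eq_bot, LinearMap.ker_eq_bot']
  intro w hw
  have hw' : ∀ i, w (B.cplx i) = 0 := fun i => by
    rw [B.cplx_eq]; exact congrFun hw i
  have : (w : V →ₛₗ[starRingEnd ℂ] ℂ) = 0 := B.cplx.ext (fun i => by simpa using hw' i)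
  ext z
  exact LinearMap.congr_fun this z

variable [FiniteDimensional ℂ V] [DiscreteTopology Λ] [IsZLattice ℝ Λ]

/-- The element `b_j^*` of the basis of `Λ^∨` dual to `(a, b)`: its pairing with a vector of `V`
is the real coordinate of this vector along `b_j`. -/
def bDualVec (j : Fin g) : AntiDual V :=
  antiOfIm ((Module.Basis.ofZLatticeBasis ℝ Λ B.lat).coord (Sum.inr j))

theorem pairing_bDualVec_a (i j : Fin g) : pairing (B.bDualVec j) (B.a i) = 0 := by
  rw [bDualVec, pairing_antiOfIm, a, ← Module.Basis.ofZLatticeBasis_apply ℝ Λ B.lat]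
  simp

theorem pairing_bDualVec_b (i j : Fin g) :
    pairing (B.bDualVec j) (B.b i) = if i = j then 1 else 0 := by
  rw [bDualVec, pairing_antiOfIm, b, ← Module.Basis.ofZLatticeBasis_apply ℝ Λ B.lat]
  simp [Finsupp.single_apply]

theorem bDualVec_linearIndependent : LinearIndependent ℂ B.bDualVec := by
  have real_case : ∀ c : Fin g → ℝ, (∀ i, ∑ j, c j * (B.bDualVec j (B.a i)).re = 0) →
      ∀ k, c k = 0 := by
    intro c hc k
    have h0 : (∑ j, (c j : ℂ) • B.bDualVec j) = 0 := by
      apply B.evalA_injective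
      ext i
      change (∑ j, (c j : ℂ) • B.bDualVec j) (B.a i) = (0 : AntiDual V) (B.a i)
      apply Complex.ext
      · simpa [sum_apply] using hc i
      · have : ∀ j, (B.bDualVec j (B.a i)).im = 0 := fun j => B.pairing_bDualVec_a i j
        simp [this]
    have h1 : ((∑ j, (c j : ℂ) • B.bDualVec j) (B.b k)).im = 0 := by rw [h0]; simp
    have h2 : ∀ j, (B.bDualVec j (B.b k)).im = if k = j then 1 else 0 :=
      fun j => B.pairing_bDualVec_b k j
    simpa [sum_apply, h2] using h1
  rw [Fintype.linearIndependent_iff]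
  intro c hc k
  have hv : ∀ i, ∑ j, c j * B.bDualVec j (B.a i) = 0 := by
    intro i
    have := congrArg (fun w : AntiDual V => w (B.a i)) hc
    simpa [sum_apply] using this
  have him : ∀ i j, (B.bDualVec j (B.a i)).im = 0 := fun i j => B.pairing_bDualVec_a i j
  apply Complex.ext
  · refine real_case (fun j => (c j).re) (fun i => ?_) k
    simpa [him] using congrArg Complex.re (hv i)
  · refine real_case (fun j => (c j).im) (fun i => ?_) k
    simpa [him] using congrArg Complex.im (hv i)

/-- The complex basis `b^*` of `V^∨`. -/
def bDual : Module.Basis (Fin g) ℂ (AntiDual V) :=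
  have : FiniteDimensional ℂ (AntiDual V) := Module.Finite.of_injective _ B.evalA_injective
  have hle : Module.finrank ℂ (AntiDual V) ≤ g := by
    simpa using LinearMap.finrank_le_finrank_of_injective B.evalA_injective
  have hge : g ≤ Module.finrank ℂ (AntiDual V) := by
    simpa using B.bDualVec_linearIndependent.fintype_card_le_finrank
  Module.Basis.mk B.bDualVec_linearIndependent
    (B.bDualVec_linearIndependent.span_eq_top_of_card_eq_finrank'
      (by simpa using le_antisymm hge hle)).ge

theorem bDual_apply (j : Fin g) : B.bDual j = B.bDualVec j := by
  simp [bDual]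

/-- The automorphy factor `exp (2πi ((w + l) μ_2 - l_1 z))`: here `w + l` is the row vector of its
coordinates in the basis `b^*`, `z` is the column vector of its coordinates in the basis `a`, the
lattice vector is `μ = ∑ i, (μ_1)_i a_i + (μ_2)_i b_i`, and the entries of `l_1` are the integers
`⟨l, a_i⟩`, that is, `l = -l_1 Ω + l_2` as a row vector. -/
def factorB (μ : Λ) (l : dualLattice Λ) (x : V × AntiDual V) : ℂ :=
  Complex.exp (2 * Real.pi * Complex.I *
    (∑ j, B.bDual.repr (x.2 + l) j * (B.lat.repr μ (Sum.inr j) : ℂ) -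
      ∑ j, (pairing (l : AntiDual V) (B.a j) : ℂ) * B.cplx.repr x.1 j))

/-- The holomorphic frame over `V × V^∨` of the Poincaré bundle that is determined by the automorphy
factor `factorB` and by the rigidification at the origin. -/
structure IsHolomorphicFrame (e : V × AntiDual V → Poincare Λ) : Prop where
  holomorphic : ∃ φ : V × AntiDual V → ℂ, Differentiable ℂ φ ∧ (∀ x, φ x ≠ 0) ∧
    ∀ x, e x = Poincare.mk x (φ x)
  automorphy : ∀ (μ : Λ) (l : dualLattice Λ) (x : V × AntiDual V),
    e x = B.factorB μ l x • e (x + ((μ : V), (l : AntiDual V)))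
  normalized : e 0 = Poincare.mk 0 1

theorem IsHolomorphicFrame.proj_eq {B : IntegralBasis Λ g} {e : V × AntiDual V → Poincare Λ}
    (he : B.IsHolomorphicFrame e) (x : V × AntiDual V) :
    (e x).proj = (Submodule.Quotient.mk x.1, Submodule.Quotient.mk x.2) := by
  obtain ⟨φ, -, -, h⟩ := he.holomorphic
  rw [h x, Poincare.proj_mk]

end IntegralBasis

end Basis

/-! ### Polarizations -/

section Polarization

variable {V : Type*} [NormedAddCommGroup V] [NormedSpace ℂ V]

/-- A polarization of `V / Λ`: a form on `Λ` with values in `ℤ`, given by its real bilinear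
extension to `V`, with the sign convention `-E(iv, v) > 0`. -/
structure Polarization (Λ : Submodule ℤ V) where
  /-- The real bilinear extension of the form. -/
  form : V →ₗ[ℝ] V →ₗ[ℝ] ℝ
  integral : ∀ μ ∈ Λ, ∀ ν ∈ Λ, ∃ n : ℤ, form μ ν = n
  antisymm : ∀ v w, form v w = -form w v
  nondegenerate : ∀ v, (∀ w, form v w = 0) → v = 0
  map_I : ∀ v w, form (Complex.I • v) (Complex.I • w) = form v w
  pos : ∀ v, v ≠ 0 → 0 < -form (Complex.I • v) v

namespace Polarization

variable {Λ : Submodule ℤ V} (E : Polarization Λ)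

/-- The hermitian form `H(v, w) = -E(iv, w) - i E(v, w)`, linear in `v` and antilinear in `w`. -/
def hermitian (v w : V) : ℂ :=
  -(E.form (Complex.I • v) w : ℂ) - Complex.I * (E.form v w : ℂ)

theorem form_I_right (v w : V) :
    E.form v (Complex.I • w) = -E.form (Complex.I • v) w := by
  have := E.map_I v (Complex.I • w)
  rw [smul_smul, Complex.I_mul_I, neg_one_smul, map_neg] at this
  exact this.symm

theorem smul_eq (c : ℂ) (v : V) : c • v = c.re • v + c.im • (Complex.I • v) := by
  conv_lhs => rw [← Complex.re_add_im c]
  rw [add_smul, mul_smul, Complex.coe_smul, Complex.coe_smul]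

theorem hermitian_smul_left (c : ℂ) (v w : V) :
    E.hermitian (c • v) w = c * E.hermitian v w := by
  have h : Complex.I • Complex.I • v = -v := by rw [smul_smul, Complex.I_mul_I, neg_one_smul]
  rw [smul_eq c v]
  apply Complex.ext <;>
    simp [hermitian, smul_comm Complex.I (_ : ℝ), h] <;> ring

theorem hermitian_smul_right (c : ℂ) (v w : V) :
    E.hermitian v (c • w) = starRingEnd ℂ c * E.hermitian v w := by
  have h : Complex.I • Complex.I • v = -v := by rw [smul_smul, Complex.I_mul_I, neg_one_smul]
  rw [smul_eq c w]
  apply Complex.ext <;>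
    simp [hermitian, E.form_I_right, h] <;> ring

/-- The linear map `V → V^∨`, `v ↦ H(v, -)`. -/
def toDual [FiniteDimensional ℂ V] : V →ₗ[ℂ] AntiDual V where
  toFun v :=
    { toFun := fun w => E.hermitian v w
      map_add' := fun w w' => by simp [hermitian]; ring
      map_smul' := fun c w => by simpa using E.hermitian_smul_right c v w
      cont := by
        have h : ∀ u, Continuous (E.form u) := fun u =>
          (E.form u).continuous_of_finiteDimensional
        have h1 := h v
        have h2 := h (Complex.I • v)
        unfold hermitian
        fun_prop }
  map_add' v v' := by
    ext w
    change E.hermitian (v + v') w = E.hermitian v w + E.hermitian v' w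
    simp [hermitian]; ring
  map_smul' c v := by
    ext w
    exact E.hermitian_smul_left c v w

theorem toDual_mem [FiniteDimensional ℂ V] {μ : V} (hμ : μ ∈ Λ) :
    E.toDual μ ∈ dualLattice Λ := by
  intro ν hν
  obtain ⟨n, hn⟩ := E.integral μ hμ ν hν
  refine ⟨-n, ?_⟩
  change (E.hermitian μ ν).im = _
  simp [hermitian, hn]

/-- The isogeny `T → T^∨` induced by `v ↦ H(v, -)`. -/
def isogeny [FiniteDimensional ℂ V] : Torus Λ →ₗ[ℤ] DualTorus Λ :=
  Λ.mapQ (dualLattice Λ) (E.toDual.restrictScalars ℤ) (fun _ h => E.toDual_mem h)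

/-- The matrix of the polarization on `(a, b)` is `(0, Δ; -Δ, 0)` with `Δ` the diagonal matrix with
diagonal entries `d`. -/
def HasType {g : ℕ} (B : IntegralBasis Λ g) (d : Fin g → ℤ) : Prop :=
  (Matrix.of fun p q => E.form (B.lat p) (B.lat q)) =
    Matrix.fromBlocks 0 (Matrix.diagonal fun i => (d i : ℝ))
      (-Matrix.diagonal fun i => (d i : ℝ)) 0

end Polarization

/-! ### The pullback of the Poincaré bundle -/

/-- The total space of the pullback of the Poincaré bundle under `f : T → T × T^∨`. -/
def Pullback {Λ : Submodule ℤ V} (f : Torus Λ → Torus Λ × DualTorus Λ) : Type _ :=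
  {p : Torus Λ × Poincare Λ // p.2.proj = f p.1}

namespace Pullback

variable {Λ : Submodule ℤ V} {f : Torus Λ → Torus Λ × DualTorus Λ}

/-- Scalar multiplication in the fibres. -/
instance : SMul ℂ (Pullback f) where
  smul c p := ⟨(p.1.1, c • p.1.2), by rw [Poincare.proj_smul]; exact p.2⟩

/-- The metric induced on the pullback. -/
def metric (N : Poincare Λ → ℝ) (p : Pullback f) : ℝ := N p.1.2

end Pullback

namespace Polarization

variable {Λ : Submodule ℤ V} [FiniteDimensional ℂ V] (E : Polarization Λ)

/-- The map `(id, λ_E) : T → T × T^∨`. -/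
def graph (t : Torus Λ) : Torus Λ × DualTorus Λ := (t, E.isogeny t)

/-- The frame over `V` of `(id, λ_E)^* P` that is the pullback of a holomorphic frame of the
Poincaré bundle `P` over `V × V^∨`. -/
def pullbackFrame [DiscreteTopology Λ] [IsZLattice ℝ Λ] {g : ℕ} {B : IntegralBasis Λ g}
    {e : V × AntiDual V → Poincare Λ} (he : B.IsHolomorphicFrame e) (v : V) :
    Pullback E.graph :=
  ⟨(Submodule.Quotient.mk v, e (v, E.toDual v)), he.proj_eq _⟩

end Polarization

end Polarization

end PoincareBundle

end

noncomputable section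
namespace PoincareBundle

/-! ### The complex Hessian and Liouville theorems for bounded functions -/

section Pluriharmonic

variable {W : Type*} [NormedAddCommGroup W] [NormedSpace ℂ W]

/-! Both existence claims have explicit witnesses, and both uniqueness claims are Liouville theorems
on a compact torus.

Metric: `|s| exp(-π Re w(z))` descends to the quotient by `norm_factorA`, and its logarithm is a
real quadratic form, so its curvature is constant. For two invariant metrics, the difference `h` of
the log norms is periodic, hence bounded, and its `∂∂̄` is translation invariant. So `h(· + y) - h`
is bounded and pluriharmonic, hence constant; then `h - h(0)` is additive and bounded, hence zero.

Frame: let `S(w, z) = ∑ w(a_i) z_i`, the complex bilinear form that agrees with `w(z)` for `z` in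
the real span of `a`. The frame is `exp(πS)` times `[x, 1]`. Two expressions for `S`,
`bilin_eq_conj` and `bilin_eq_sub`, show that this factor turns one automorphy factor into the
other. The quotient of two frames is entire and periodic, hence constant.

Formula: the frame has norm `exp(π Re(S(w, z) - w(z)))`. At `w = H(z, -)` the exponent involves only
`E(z, a_i)`, that is, the coordinates of `z` along `b`, which are `(Im Ω)⁻¹ Im z`. -/

theorem fderiv_dbar {f : W → ℝ} (hf : ContDiff ℝ 2 f) (x u v : W) :
    fderiv ℝ (fun y => dbar f y v) x u =
      (1 / 2) * ((fderiv ℝ (fderiv ℝ f) x u v : ℂ) +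
        Complex.I * (fderiv ℝ (fderiv ℝ f) x u (Complex.I • v) : ℂ)) := by
  have h : ContDiff ℝ 1 (fderiv ℝ f) := hf.fderiv_right (by norm_num)
  have hd : HasFDerivAt (fderiv ℝ f) (fderiv ℝ (fderiv ℝ f) x) x :=
    (h.differentiable (by norm_num) x).hasFDerivAt
  have h' (v : W) : HasFDerivAt (fun y => ((fderiv ℝ f y v : ℝ) : ℂ))
      (Complex.ofRealCLM.comp ((fderiv ℝ (fderiv ℝ f) x).flip v)) x := by
    have := hd.clm_apply (hasFDerivAt_const v x)
    refine (Complex.ofRealCLM.hasFDerivAt.comp x this).congr_fderiv ?_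
    ext w
    simp
  have := (((h' v).add ((h' (Complex.I • v)).const_mul Complex.I)).const_mul (1 / 2 : ℂ)).fderiv
  unfold dbar
  refine (DFunLike.congr_fun this u).trans ?_
  simp
  ring

theorem ddbar_eq {f : W → ℝ} (hf : ContDiff ℝ 2 f) (x u v : W) :
    ddbar f x u v =
      (1 / 2) * ((fderiv ℝ (fderiv ℝ f) x u v : ℂ) +
        Complex.I * (fderiv ℝ (fderiv ℝ f) x u (Complex.I • v) : ℂ)) -
      (1 / 2) * ((fderiv ℝ (fderiv ℝ f) x v u : ℂ) +
        Complex.I * (fderiv ℝ (fderiv ℝ f) x v (Complex.I • u) : ℂ)) := by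
  rw [ddbar, fderiv_dbar hf, fderiv_dbar hf]

theorem ddbar_sub {f g : W → ℝ} (hf : ContDiff ℝ 2 f) (hg : ContDiff ℝ 2 g) (x u v : W) :
    ddbar (fun y => f y - g y) x u v = ddbar f x u v - ddbar g x u v := by
  have hd (u v : W) : fderiv ℝ (fderiv ℝ (fun y => f y - g y)) x u v =
      fderiv ℝ (fderiv ℝ f) x u v - fderiv ℝ (fderiv ℝ g) x u v := by
    have h1 : fderiv ℝ (fun y => f y - g y) = fun y => fderiv ℝ f y - fderiv ℝ g y := by
      ext1 y
      exact fderiv_fun_sub (hf.differentiable (by norm_num) y) (hg.differentiable (by norm_num) y)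
    rw [h1, fderiv_fun_sub ((hf.fderiv_right (m := 1) (by norm_num)).differentiable (by norm_num) x)
      ((hg.fderiv_right (m := 1) (by norm_num)).differentiable (by norm_num) x)]
    rfl
  rw [ddbar_eq (hf.sub hg), ddbar_eq hf, ddbar_eq hg]
  simp only [hd]
  push_cast
  ring

theorem ddbar_comp_add_right (f : W → ℝ) (x y u v : W) :
    ddbar (fun x => f (x + y)) x u v = ddbar f (x + y) u v := by
  have h (v : W) : (fun z => dbar (fun x => f (x + y)) z v) = fun z => dbar f (z + y) v := by
    ext z
    simp only [dbar, fderiv_comp_add_right]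
  rw [ddbar, h u, h v, fderiv_comp_add_right (f := fun z => dbar f z v),
    fderiv_comp_add_right (f := fun z => dbar f z u), ddbar]

/-- Restriction to a complex line: with `c = 1` and `c = i` this gives the Laplacian of the
restriction. -/
theorem hessian_line {f : W → ℝ} (hf : ContDiff ℝ 2 f) (x u : W) (t c : ℂ) :
    iteratedFDeriv ℝ 2 (fun t : ℂ => f (x + t • u)) t ![c, c] =
      fderiv ℝ (fderiv ℝ f) (x + t • u) (c • u) (c • u) := by
  let L : ℂ →L[ℝ] W := ((ContinuousLinearMap.id ℂ ℂ).smulRight u).restrictScalars ℝ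
  have hL : ∀ t : ℂ, HasFDerivAt (fun t : ℂ => x + t • u) L t := fun t =>
    L.hasFDerivAt.const_add x
  have h1 : fderiv ℝ (fun t : ℂ => f (x + t • u)) = fun t => (fderiv ℝ f (x + t • u)).comp L := by
    ext1 t
    exact ((hf.differentiable (by norm_num) (x + t • u)).hasFDerivAt.comp t (hL t)).fderiv
  have h2 : HasFDerivAt (fderiv ℝ f) (fderiv ℝ (fderiv ℝ f) (x + t • u)) (x + t • u) :=
    ((hf.fderiv_right (m := 1) (by norm_num)).differentiable (by norm_num) _).hasFDerivAt
  have h3 := (h2.comp t (hL t)).clm_comp (hasFDerivAt_const L t)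
  rw [iteratedFDeriv_two_apply, h1]
  refine (congrArg (fun A => A c c) h3.fderiv).trans ?_
  simp [L]

/-- A bounded pluriharmonic function is constant. -/
theorem eq_of_ddbar_eq_zero_of_bounded {f : W → ℝ} (hf : ContDiff ℝ 2 f)
    (h0 : ∀ x u v, ddbar f x u v = 0) {C : ℝ} (hC : ∀ x, |f x| ≤ C) (x y : W) : f x = f y := by
  have hlap (x u : W) : fderiv ℝ (fderiv ℝ f) x u u +
      fderiv ℝ (fderiv ℝ f) x (Complex.I • u) (Complex.I • u) = 0 := by
    -- The imaginary part of `∂∂̄f(u, iu)` is `-1/2` times the sum in the goal.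
    have h := h0 x u (Complex.I • u)
    rw [ddbar_eq hf, smul_smul, Complex.I_mul_I, neg_one_smul, map_neg] at h
    have := congrArg Complex.im h
    simp at this
    linarith
  -- The complex line through `x` (at `t = 0`) and `y` (at `t = 1`) reduces the claim to Liouville
  -- for harmonic functions on `ℂ`.
  have hharm : InnerProductSpace.HarmonicOnNhd (fun t : ℂ => f (x + t • (y - x))) Set.univ := by
    intro t _
    refine ⟨?_, ?_⟩
    · have : ContDiff ℝ 2 (fun t : ℂ => x + t • (y - x)) := by fun_prop
      exact (hf.comp this).contDiffAt
    · refine Filter.Eventually.of_forall fun t => ?_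
      rw [InnerProductSpace.laplacian_eq_iteratedFDeriv_complexPlane]
      simp only [hessian_line hf]
      simpa using hlap _ (y - x)
  have hb : Bornology.IsBounded (Set.range (fun t : ℂ => f (x + t • (y - x)))) := by
    rw [isBounded_iff_forall_norm_le]
    refine ⟨C, ?_⟩
    rintro _ ⟨t, rfl⟩
    exact hC _
  simpa using InnerProductSpace.bounded_harmonic_on_complex_plane_is_constant _ hharm hb 0 1

/-- A bounded function with translation invariant `∂∂̄` is constant. -/
theorem eq_of_ddbar_invariant_of_bounded {f : W → ℝ} (hf : ContDiff ℝ 2 f)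
    (h0 : ∀ x y u v, ddbar f (x + y) u v = ddbar f x u v) {C : ℝ} (hC : ∀ x, |f x| ≤ C) (y : W) :
    f y = f 0 := by
  have hadd (x y : W) : f (x + y) - f x = f y - f 0 := by
    have hs : ContDiff ℝ 2 (fun x => f (x + y)) := hf.comp (contDiff_id.add contDiff_const)
    have h := eq_of_ddbar_eq_zero_of_bounded (hs.sub hf) (C := C + C) (fun x u v => by
      rw [ddbar_sub hs hf, ddbar_comp_add_right, h0, sub_self])
      (fun x => (abs_sub _ _).trans (add_le_add (hC _) (hC _))) x 0
    simpa using h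
  -- By additivity a nonzero increment would grow linearly along the multiples of `y`, against the
  -- bound.
  have hn (n : ℕ) : f (n • y) - f 0 = n * (f y - f 0) := by
    induction n with
    | zero => simp
    | succ n ih =>
      have := hadd (n • y) y
      rw [succ_nsmul]
      push_cast
      linarith
  by_contra hne
  have hpos : 0 < |f y - f 0| := abs_pos.2 (sub_ne_zero.2 hne)
  obtain ⟨n, hn'⟩ := exists_nat_gt ((C + C) / |f y - f 0|)
  rw [div_lt_iff₀ hpos] at hn'
  have h1 : |f (n • y) - f 0| ≤ C + C := (abs_sub _ _).trans (add_le_add (hC _) (hC _))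
  rw [hn, abs_mul, Nat.abs_cast] at h1
  linarith

end Pluriharmonic

theorem two_le_infty : (2 : WithTop ℕ∞) ≤ ∞ := WithTop.coe_le_coe.2 le_top

section Forms

variable {W : Type*} [NormedAddCommGroup W] [NormedSpace ℂ W]

theorem ddbar_eq_zero_of_affine {f : W → ℝ} (hf : ContDiff ℝ 2 f)
    (h : ∀ x y, f (x + y) = f x + (f y - f 0)) (x u v : W) : ddbar f x u v = 0 := by
  have h1 : fderiv ℝ f = fun _ => fderiv ℝ f 0 := by
    ext1 y
    have h2 := fderiv_comp_add_right (𝕜 := ℝ) (f := f) (x := 0) y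
    rw [zero_add] at h2
    rw [← h2, funext fun x => h x y, fderiv_add_const]
  rw [ddbar_eq hf, h1]
  simp

end Forms

/-! ### The invariant norm on the total space -/

section Poincare

variable {V : Type*} [NormedAddCommGroup V] [NormedSpace ℂ V] {Λ : Submodule ℤ V}

/-- The lattice acts freely on the base, so only the trivial translation fixes `x`. -/
theorem Poincare.mk_injective (x : V × AntiDual V) :
    Function.Injective (Poincare.mk x : ℂ → Poincare Λ) := by
  intro s t h
  obtain ⟨γ, -, -, h⟩ := Quotient.exact h
  obtain ⟨h1, h2⟩ := Prod.ext_iff.1 h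
  have hγ : γ = 0 := by simpa using h1
  simpa [hγ, factorA_zero] using h2.symm

theorem Poincare.exists_mk_eq (p : Poincare Λ) : ∃ x s, p = Poincare.mk x s :=
  Quotient.inductionOn p fun q => ⟨q.1, q.2, rfl⟩

/-- Conjugation does not change real parts, so the absolute value of the factor is the coboundary of
`exp(π Re w(z))`. -/
theorem norm_factorA (γ x : V × AntiDual V) :
    ‖factorA γ x‖ = Real.exp (Real.pi * (((x.2 + γ.2) (x.1 + γ.1)).re - (x.2 x.1).re)) := by
  rw [factorA, Complex.norm_exp]
  congr 1
  simp
  ring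

/-- The invariant norm `‖[(z, w), s]‖ = |s| exp (-π Re (w z))`. -/
def invariantNorm (Λ : Submodule ℤ V) : Poincare Λ → ℝ :=
  Quotient.lift (fun p => ‖p.2‖ * Real.exp (-Real.pi * (p.1.2 p.1.1).re)) (by
    rintro ⟨x, s⟩ _ ⟨γ, -, -, rfl⟩
    simp only [norm_mul, norm_factorA, Prod.fst_add, Prod.snd_add]
    rw [mul_right_comm, ← Real.exp_add, mul_comm]
    congr 2
    ring)

theorem invariantNorm_mk (x : V × AntiDual V) (s : ℂ) :
    invariantNorm Λ (Poincare.mk x s) = ‖s‖ * Real.exp (-Real.pi * (x.2 x.1).re) := rfl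

theorem IsMetric.apply_mk {N : Poincare Λ → ℝ} (hN : IsMetric N) (x : V × AntiDual V) (s : ℂ) :
    N (Poincare.mk x s) = ‖s‖ * N (Poincare.mk x 1) := by
  rw [← hN.norm_smul, Poincare.smul_mk, mul_one]

theorem IsMetric.log_smooth {N : Poincare Λ → ℝ} (hN : IsMetric N) :
    ContDiff ℝ 2 fun x : V × AntiDual V => Real.log (N (Poincare.mk x 1) ^ 2) := by
  have h : ContDiff ℝ ∞ fun x : V × AntiDual V => N (Poincare.mk x 1) ^ 2 := hN.smooth
  exact (h.log fun x => (pow_pos (hN.pos x) 2).ne').of_le two_le_infty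

/-- The correction term does not depend on the metric, so it cancels in the difference of two log
norms. -/
theorem IsMetric.log_add {N : Poincare Λ → ℝ} (hN : IsMetric N) (x γ : V × AntiDual V)
    (h1 : γ.1 ∈ Λ) (h2 : γ.2 ∈ dualLattice Λ) :
    Real.log (N (Poincare.mk (x + γ) 1) ^ 2) =
      Real.log (N (Poincare.mk x 1) ^ 2) - 2 * Real.log ‖factorA γ x‖ := by
  have hne : ‖factorA γ x‖ ≠ 0 := norm_ne_zero_iff.2 (Complex.exp_ne_zero _)
  have h := Poincare.mk_add x γ 1 h1 h2
  rw [← h, mul_one, hN.apply_mk (x + γ) (factorA γ x), Real.log_pow, Real.log_pow,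
    Real.log_mul hne (hN.pos _).ne']
  push_cast
  ring

/-- Antilinearity gives `Im w(iz) = -Re w(z)`, so the imaginary part determines the form. -/
theorem antiDual_ext_pairing {w w' : AntiDual V} (h : ∀ z, pairing w z = pairing w' z) :
    w = w' := by
  ext z
  have h1 := h z
  have h2 := h (Complex.I • z)
  simp only [pairing, map_smulₛₗ] at h1 h2
  apply Complex.ext
  · simpa using h2
  · exact h1

end Poincare

/-! ### The bilinear form `S`, periodic functions and uniqueness of the metric -/

namespace IntegralBasis

variable {V : Type*} [NormedAddCommGroup V] [NormedSpace ℂ V] {Λ : Submodule ℤ V} {g : ℕ}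
  (B : IntegralBasis Λ g)

theorem apply_eq_sum (w : AntiDual V) (z : V) :
    w z = ∑ i, w (B.a i) * starRingEnd ℂ (B.cplx.repr z i) := by
  conv_lhs => rw [← B.cplx.sum_repr z]
  simp [map_sum, B.cplx_eq, a, mul_comm]

/-- The complex bilinear form `S(w, z) = ∑ i, w(a_i) z_i`. -/
def bilin (w : AntiDual V) (z : V) : ℂ := ∑ i, w (B.a i) * B.cplx.repr z i

theorem bilin_add (w l : AntiDual V) (z μ : V) :
    B.bilin (w + l) (z + μ) = B.bilin w z + B.bilin (w + l) μ + B.bilin l z := by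
  simp only [bilin, ← Finset.sum_add_distrib]
  refine Finset.sum_congr rfl fun i _ => ?_
  simp
  ring

/-- Replace each `w(a_i)` by its conjugate plus `2i` times its imaginary part; the conjugates sum to
the conjugate of `w(z)`. -/
theorem bilin_eq_conj (w : AntiDual V) (z : V) :
    B.bilin w z = starRingEnd ℂ (w z) +
      2 * Complex.I * ∑ i, (pairing w (B.a i) : ℂ) * B.cplx.repr z i := by
  rw [B.apply_eq_sum w z, map_sum, Finset.mul_sum, ← Finset.sum_add_distrib, bilin]
  refine Finset.sum_congr rfl fun i _ => ?_
  have h : w (B.a i) = starRingEnd ℂ (w (B.a i)) + 2 * Complex.I * (pairing w (B.a i) : ℂ) := by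
    apply Complex.ext <;> simp [pairing]
    ring
  conv_lhs => rw [h]
  simp
  ring

theorem contDiff_repr [FiniteDimensional ℂ V] (i : Fin g) :
    ContDiff ℂ ∞ fun z => B.cplx.repr z i :=
  (LinearMap.toContinuousLinearMap (B.cplx.coord i)).contDiff

variable [FiniteDimensional ℂ V] [DiscreteTopology Λ] [IsZLattice ℝ Λ]

theorem finiteDimensional_antiDual (B : IntegralBasis Λ g) : FiniteDimensional ℂ (AntiDual V) :=
  Module.Finite.of_basis B.bDual

theorem contDiff_eval (i : Fin g) : ContDiff ℂ ∞ fun w : AntiDual V => w (B.a i) :=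
  have := B.finiteDimensional_antiDual
  (LinearMap.toContinuousLinearMap ((LinearMap.proj i).comp B.evalA)).contDiff

theorem contDiff_re_apply (B : IntegralBasis Λ g) :
    ContDiff ℝ ∞ fun x : V × AntiDual V => (x.2 x.1).re := by
  have h1 (i : Fin g) : ContDiff ℝ ∞ fun x : V × AntiDual V => x.2 (B.a i) :=
    ((B.contDiff_eval i).restrict_scalars ℝ).comp contDiff_snd
  have h2 (i : Fin g) : ContDiff ℝ ∞ fun x : V × AntiDual V => B.cplx.repr x.1 i :=
    ((B.contDiff_repr i).restrict_scalars ℝ).comp contDiff_fst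
  have h3 (i : Fin g) : ContDiff ℝ ∞ fun x : V × AntiDual V =>
      starRingEnd ℂ (B.cplx.repr x.1 i) := Complex.conjCLE.contDiff.comp (h2 i)
  simp only [fun x : V × AntiDual V => B.apply_eq_sum x.2 x.1]
  exact Complex.reCLM.contDiff.comp (ContDiff.sum fun i _ => (h1 i).mul (h3 i))

theorem isInvariantMetric_invariantNorm (B : IntegralBasis Λ g) :
    IsInvariantMetric (invariantNorm Λ) where
  norm_smul c p := by
    obtain ⟨x, s, rfl⟩ := p.exists_mk_eq
    rw [Poincare.smul_mk, invariantNorm_mk, invariantNorm_mk, norm_mul, mul_assoc]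
  pos x := by simp [invariantNorm_mk, Real.exp_pos]
  smooth := by
    have := B.contDiff_re_apply
    simp only [IsSmooth, invariantNorm_mk]
    fun_prop
  curvature_invariant x y u v := by
    have hlog : (fun x : V × AntiDual V => Real.log (invariantNorm Λ (Poincare.mk x 1) ^ 2)) =
        fun x => -2 * Real.pi * (x.2 x.1).re := by
      ext x
      simp [invariantNorm_mk]
      ring
    set f := fun x : V × AntiDual V => -2 * Real.pi * (x.2 x.1).re with hf
    have hs : ContDiff ℝ 2 f :=
      (contDiff_const.mul B.contDiff_re_apply).of_le two_le_infty
    have hs' : ContDiff ℝ 2 (fun x => f (x + y)) := hs.comp (contDiff_id.add contDiff_const)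
    rw [curvature, curvature, hlog, neg_inj, ← ddbar_comp_add_right, ← sub_eq_zero,
      ← ddbar_sub hs' hs]
    -- A translate of a quadratic form differs from it by an affine function.
    refine ddbar_eq_zero_of_affine (hs'.sub hs) (fun x z => ?_) x u v
    simp [hf]
    ring
  normalized := by simp [invariantNorm_mk]

/-- The antilinear form with given real coordinates in the basis of `V^∨` dual to `(a, b)`. -/
def dualOfCoords : (Fin g ⊕ Fin g → ℝ) →ₗ[ℝ] AntiDual V where
  toFun r := antiOfIm (∑ p, r p • (Module.Basis.ofZLatticeBasis ℝ Λ B.lat).coord p)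
  map_add' r r' := antiDual_ext_pairing fun z => by
    rw [pairing_antiOfIm]
    have h (w w' : AntiDual V) : pairing (w + w') z = pairing w z + pairing w' z := by
      simp [pairing]
    rw [h, pairing_antiOfIm, pairing_antiOfIm]
    simp [-Fintype.sum_sum_type, add_mul, Finset.sum_add_distrib]
  map_smul' c r := antiDual_ext_pairing fun z => by
    rw [pairing_antiOfIm]
    have h (w : AntiDual V) : pairing (c • w) z = c * pairing w z := by
      simp [pairing]
    rw [RingHom.id_apply, h, pairing_antiOfIm]
    simp [-Fintype.sum_sum_type, Finset.mul_sum, mul_assoc]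

theorem pairing_dualOfCoords (r : Fin g ⊕ Fin g → ℝ) (z : V) :
    pairing (B.dualOfCoords r) z =
      ∑ p, r p * (Module.Basis.ofZLatticeBasis ℝ Λ B.lat).repr z p := by
  change pairing (antiOfIm _) z = _
  rw [pairing_antiOfIm]
  simp

theorem dualOfCoords_pairing (w : AntiDual V) :
    B.dualOfCoords (fun p => pairing w (B.lat p)) = w := by
  refine antiDual_ext_pairing fun z => ?_
  rw [pairing_dualOfCoords]
  conv_rhs => rw [← (Module.Basis.ofZLatticeBasis ℝ Λ B.lat).sum_repr z]
  simp only [pairing, map_sum, Complex.im_sum]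
  refine Finset.sum_congr rfl fun p _ => ?_
  rw [B.lat.ofZLatticeBasis_apply ℝ Λ, ← Complex.coe_smul, map_smulₛₗ]
  simp [mul_comm]

theorem dualOfCoords_mem (n : Fin g ⊕ Fin g → ℤ) :
    B.dualOfCoords (fun p => (n p : ℝ)) ∈ dualLattice Λ := by
  intro μ hμ
  refine ⟨∑ p, n p * B.lat.repr ⟨μ, hμ⟩ p, ?_⟩
  rw [pairing_dualOfCoords]
  push_cast
  refine Finset.sum_congr rfl fun p _ => ?_
  rw [← Module.Basis.ofZLatticeBasis_repr_apply ℝ Λ B.lat ⟨μ, hμ⟩ p]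

/-- A continuous function on `V × V^∨` that is periodic under `Λ × Λ^∨` is bounded. -/
theorem bounded_of_periodic (B : IntegralBasis Λ g) {F : Type*} [NormedAddCommGroup F]
    {f : V × AntiDual V → F}
    (hf : Continuous f)
    (hper : ∀ x γ : V × AntiDual V, γ.1 ∈ Λ → γ.2 ∈ dualLattice Λ → f (x + γ) = f x) :
    ∃ C : ℝ, ∀ x, ‖f x‖ ≤ C := by
  let b := Module.Basis.ofZLatticeBasis ℝ Λ B.lat
  let φ : (Fin g ⊕ Fin g → ℝ) × (Fin g ⊕ Fin g → ℝ) → V × AntiDual V :=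
    fun r => (∑ p, r.1 p • b p, B.dualOfCoords r.2)
  have hφ : Continuous φ := by
    have : Continuous B.dualOfCoords := B.dualOfCoords.continuous_of_finiteDimensional
    fun_prop
  obtain ⟨C, hC⟩ := ((isCompact_Icc (a := (0 : (Fin g ⊕ Fin g → ℝ) × (Fin g ⊕ Fin g → ℝ)))
    (b := 1)).exists_bound_of_continuousOn (hf.comp hφ).continuousOn)
  refine ⟨C, fun x => ?_⟩
  -- Fractional parts of the coordinates give the representative in the unit cube, integer parts the
  -- lattice translation.
  let r : (Fin g ⊕ Fin g → ℝ) × (Fin g ⊕ Fin g → ℝ) :=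
    (fun p => Int.fract (b.repr x.1 p), fun p => Int.fract (pairing x.2 (B.lat p)))
  let γ : V × AntiDual V := (∑ p, ⌊b.repr x.1 p⌋ • (B.lat p : V),
    B.dualOfCoords fun p => (⌊pairing x.2 (B.lat p)⌋ : ℝ))
  have hx : φ r + γ = x := by
    ext1
    · conv_rhs => rw [← b.sum_repr x.1]
      simp only [φ, r, γ, Prod.fst_add, ← Finset.sum_add_distrib]
      refine Finset.sum_congr rfl fun p _ => ?_
      have : (B.lat p : V) = b p := (B.lat.ofZLatticeBasis_apply ℝ Λ p).symm
      rw [this, ← Int.cast_smul_eq_zsmul ℝ, ← add_smul, Int.fract_add_floor]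
    · conv_rhs => rw [← B.dualOfCoords_pairing x.2]
      simp only [φ, r, γ, Prod.snd_add, ← map_add]
      congr 1
      ext p
      simp [Int.fract_add_floor]
  have h1 : ∑ p, ⌊b.repr x.1 p⌋ • (B.lat p : V) ∈ Λ :=
    Submodule.sum_mem _ fun p _ => Λ.smul_mem _ (B.lat p).2
  rw [← hx, hper _ _ h1 (B.dualOfCoords_mem _)]
  refine hC r ⟨⟨fun p => Int.fract_nonneg _, fun p => Int.fract_nonneg _⟩,
    ⟨fun p => (Int.fract_lt_one _).le, fun p => (Int.fract_lt_one _).le⟩⟩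

theorem eq_invariantNorm (B : IntegralBasis Λ g) {N : Poincare Λ → ℝ} (hN : IsInvariantMetric N) :
    N = invariantNorm Λ := by
  have hN' := B.isInvariantMetric_invariantNorm
  have hs := hN.toIsMetric.log_smooth
  have hs' := hN'.toIsMetric.log_smooth
  obtain ⟨C, hC⟩ := B.bounded_of_periodic (hs.sub hs').continuous fun x γ h1 h2 => by
    rw [hN.toIsMetric.log_add x γ h1 h2, hN'.toIsMetric.log_add x γ h1 h2]
    ring
  have hconst := eq_of_ddbar_invariant_of_bounded (hs.sub hs') (fun x y u v => by
    have h := hN.curvature_invariant x y u v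
    have h' := hN'.curvature_invariant x y u v
    simp only [curvature, neg_inj] at h h'
    rw [ddbar_sub hs hs', ddbar_sub hs hs', h, h']) hC
  ext p
  obtain ⟨x, s, rfl⟩ := p.exists_mk_eq
  rw [hN.toIsMetric.apply_mk, hN'.toIsMetric.apply_mk]
  congr 1
  have h := hconst x
  rw [hN.normalized, hN'.normalized, sub_self, sub_eq_zero, Real.log_pow, Real.log_pow] at h
  exact Real.log_injOn_pos (hN.pos x) (hN'.pos x) (by simpa using h)

end IntegralBasis

/-! ### The holomorphic frame and the period matrix -/

namespace IntegralBasis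

variable {V : Type*} [NormedAddCommGroup V] [NormedSpace ℂ V] {Λ : Submodule ℤ V} {g : ℕ}
  (B : IntegralBasis Λ g)

/-- The coefficient of the holomorphic frame with respect to the frame `x ↦ [x, 1]`. -/
def frameCoeff (x : V × AntiDual V) : ℂ := Complex.exp (Real.pi * B.bilin x.2 x.1)

theorem frameCoeff_ne_zero (x : V × AntiDual V) : B.frameCoeff x ≠ 0 := Complex.exp_ne_zero _

variable [FiniteDimensional ℂ V] [DiscreteTopology Λ] [IsZLattice ℝ Λ]

theorem pairing_bDualVec (j : Fin g) (z : V) :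
    pairing (B.bDualVec j) z = (B.lat.ofZLatticeBasis ℝ Λ).repr z (Sum.inr j) := by
  rw [bDualVec, pairing_antiOfIm, Module.Basis.coord_apply]

/-- Since `b_j^*` pairs to zero with `a`, `S(b_j^*, z)` is just the conjugate of `b_j^*(z)`. -/
theorem bilin_bDualVec (j : Fin g) (z : V) :
    B.bilin (B.bDualVec j) z = B.bDualVec j z -
      2 * Complex.I * ((B.lat.ofZLatticeBasis ℝ Λ).repr z (Sum.inr j) : ℂ) := by
  rw [bilin_eq_conj, ← pairing_bDualVec]
  simp only [pairing_bDualVec_a]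
  apply Complex.ext <;> simp [pairing]
  ring

theorem bilin_eq_sub (w : AntiDual V) (z : V) :
    B.bilin w z = w z - 2 * Complex.I * ∑ j, B.bDual.repr w j *
      ((B.lat.ofZLatticeBasis ℝ Λ).repr z (Sum.inr j) : ℂ) := by
  have h (z : V) : w z = ∑ j, B.bDual.repr w j * B.bDualVec j z := by
    conv_lhs => rw [← B.bDual.sum_repr w]
    simp [sum_apply, bDual_apply]
  have h' : B.bilin w z = ∑ j, B.bDual.repr w j * B.bilin (B.bDualVec j) z := by
    simp only [bilin, Finset.mul_sum, h, Finset.sum_mul]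
    rw [Finset.sum_comm]
    simp only [mul_assoc]
  rw [h', h z, Finset.mul_sum, ← Finset.sum_sub_distrib]
  refine Finset.sum_congr rfl fun j _ => ?_
  rw [bilin_bDualVec]
  ring

theorem differentiable_frameCoeff : Differentiable ℂ B.frameCoeff := by
  have h1 (i : Fin g) : Differentiable ℂ fun x : V × AntiDual V => x.2 (B.a i) :=
    ((B.contDiff_eval i).differentiable (by simp)).comp differentiable_snd
  have h2 (i : Fin g) : Differentiable ℂ fun x : V × AntiDual V => B.cplx.repr x.1 i :=
    ((B.contDiff_repr i).differentiable (by simp)).comp differentiable_fst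
  have h3 : Differentiable ℂ fun x : V × AntiDual V => B.bilin x.2 x.1 :=
    Differentiable.fun_sum fun i _ => (h1 i).mul (h2 i)
  exact (h3.const_mul _).cexp

/-- Translation changes `S` by `S(w + l, μ) + S(l, z)`. Expanding the first term by `bilin_eq_sub`
and the second by `bilin_eq_conj` yields the exponent of `factorA` minus that of `factorB`. -/
theorem factorB_mul_frameCoeff (μ : Λ) (l : dualLattice Λ) (x : V × AntiDual V) :
    B.factorB μ l x * B.frameCoeff (x + ((μ : V), (l : AntiDual V))) =
      factorA ((μ : V), (l : AntiDual V)) x * B.frameCoeff x := by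
  simp only [factorB, frameCoeff, factorA, ← Complex.exp_add, Prod.fst_add, Prod.snd_add,
    B.bilin_add]
  rw [B.bilin_eq_sub (x.2 + l) μ, B.bilin_eq_conj l x.1]
  simp only [Module.Basis.ofZLatticeBasis_repr_apply]
  congr 1
  push_cast
  ring

theorem isHolomorphicFrame_frameCoeff :
    B.IsHolomorphicFrame fun x => Poincare.mk x (B.frameCoeff x) where
  holomorphic := ⟨B.frameCoeff, B.differentiable_frameCoeff, B.frameCoeff_ne_zero, fun _ => rfl⟩
  automorphy μ l x := by
    rw [Poincare.smul_mk, factorB_mul_frameCoeff, Poincare.mk_add _ _ _ μ.2 l.2]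
  normalized := by simp [frameCoeff, bilin]

theorem factorB_ne_zero (μ : Λ) (l : dualLattice Λ) (x : V × AntiDual V) :
    B.factorB μ l x ≠ 0 := Complex.exp_ne_zero _

theorem IsHolomorphicFrame.eq_frameCoeff {B : IntegralBasis Λ g} {e : V × AntiDual V → Poincare Λ}
    (he : B.IsHolomorphicFrame e) : e = fun x => Poincare.mk x (B.frameCoeff x) := by
  obtain ⟨φ, hφ, -, h⟩ := he.holomorphic
  have haut (μ : Λ) (l : dualLattice Λ) (x : V × AntiDual V) :
      B.factorB μ l x * φ (x + ((μ : V), (l : AntiDual V))) =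
        factorA ((μ : V), (l : AntiDual V)) x * φ x := by
    have h1 := he.automorphy μ l x
    rw [h, h, Poincare.smul_mk, ← Poincare.mk_add x ((μ : V), (l : AntiDual V)) _ μ.2 l.2] at h1
    exact (Poincare.mk_injective _ h1).symm
  have hd : Differentiable ℂ fun x => φ x / B.frameCoeff x := by
    simp only [div_eq_mul_inv]
    exact hφ.mul (B.differentiable_frameCoeff.inv B.frameCoeff_ne_zero)
  obtain ⟨C, hC⟩ := B.bounded_of_periodic hd.continuous fun x γ h1 h2 => by
    have e1 := haut ⟨γ.1, h1⟩ ⟨γ.2, h2⟩ x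
    have e2 := B.factorB_mul_frameCoeff ⟨γ.1, h1⟩ ⟨γ.2, h2⟩ x
    have hA : factorA γ x ≠ 0 := Complex.exp_ne_zero _
    have hB := B.factorB_ne_zero ⟨γ.1, h1⟩ ⟨γ.2, h2⟩ x
    -- Expanding by `factorB` turns numerator and denominator into `factorA` multiples of their
    -- values at `x`.
    rw [← mul_div_mul_left _ _ hB]
    exact (congrArg₂ (· / ·) e1 e2).trans (mul_div_mul_left _ _ hA)
  have hb : Bornology.IsBounded (Set.range fun x => φ x / B.frameCoeff x) := by
    rw [isBounded_iff_forall_norm_le]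
    refine ⟨C, ?_⟩
    rintro _ ⟨x, rfl⟩
    exact hC x
  have h0 : φ 0 = 1 := Poincare.mk_injective (Λ := Λ) 0 ((h 0).symm.trans he.normalized)
  have h0' : B.frameCoeff 0 = 1 := by simp [frameCoeff, bilin]
  ext1 x
  have := hd.apply_eq_apply_of_bounded hb x 0
  simp only [h0, h0', div_one] at this
  rw [h x, (div_eq_one_iff_eq (B.frameCoeff_ne_zero x)).1 this]

/-- The imaginary parts of the complex coordinates along `a` of a vector are obtained by applying
`Im Ω` to its real coordinates along `b`. -/
theorem im_repr_eq (v : V) :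
    (fun i => (B.cplx.repr v i).im) = (B.periodMatrix.map Complex.im).mulVec
      fun j => (B.lat.ofZLatticeBasis ℝ Λ).repr v (Sum.inr j) := by
  ext i
  conv_lhs => rw [← (B.lat.ofZLatticeBasis ℝ Λ).sum_repr v]
  have ha (j : Fin g) : (B.lat (Sum.inl j) : V) = B.cplx j := (B.cplx_eq j).symm
  have hb (j : Fin g) : B.cplx.repr (B.lat (Sum.inr j) : V) i = B.periodMatrix i j := rfl
  have him (c : ℝ) (z : V) : (B.cplx.repr (c • z) i).im = c * (B.cplx.repr z i).im := by
    rw [← Complex.coe_smul, map_smul, Finsupp.smul_apply, smul_eq_mul, Complex.im_ofReal_mul]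
  rw [map_sum, Finsupp.finsetSum_apply, Complex.im_sum, Fintype.sum_sum_type]
  simp only [him, B.lat.ofZLatticeBasis_apply ℝ Λ, ha, hb]
  have hz (j : Fin g) : ((B.cplx.repr (B.cplx j)) i).im = 0 := by
    rw [B.cplx.repr_self, Finsupp.single_apply]
    split_ifs <;> simp
  simp only [hz, mul_zero, Finset.sum_const_zero, zero_add]
  simp [Matrix.mulVec, dotProduct, mul_comm]

theorem isUnit_det_im_periodMatrix : IsUnit (B.periodMatrix.map Complex.im).det := by
  rw [← Matrix.isUnit_iff_isUnit_det, ← Matrix.mulVec_surjective_iff_isUnit]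
  intro y
  -- Any real `y` is the imaginary part of the coordinate vector `iy`, so `Im Ω` is surjective.
  let v : V := B.cplx.equivFun.symm fun i => Complex.I * (y i : ℂ)
  refine ⟨_, (B.im_repr_eq v).symm.trans ?_⟩
  ext i
  have : B.cplx.repr v i = Complex.I * (y i : ℂ) :=
    congrFun (B.cplx.equivFun.apply_symm_apply _) i
  simp [this]

end IntegralBasis

/-! ### The metric along the graph of the polarization -/

namespace Polarization

variable {V : Type*} [NormedAddCommGroup V] [NormedSpace ℂ V] [FiniteDimensional ℂ V]
  {Λ : Submodule ℤ V} [DiscreteTopology Λ] [IsZLattice ℝ Λ] {E : Polarization Λ} {g : ℕ}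
  {B : IntegralBasis Λ g} {d : Fin g → ℤ}

theorem HasType.form_a (hd : E.HasType B d) (v : V) (i : Fin g) :
    E.form v (B.a i) = -(d i * (B.lat.ofZLatticeBasis ℝ Λ).repr v (Sum.inr i)) := by
  have h (p q) := congrFun (congrFun hd p) q
  have h1 (j : Fin g) : E.form (B.lat (Sum.inl j)) (B.a i) = 0 := h (Sum.inl j) (Sum.inl i)
  have h2 (j : Fin g) : E.form (B.lat (Sum.inr j)) (B.a i) =
      -Matrix.diagonal (fun i => (d i : ℝ)) j i :=
    h (Sum.inr j) (Sum.inl i)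
  conv_lhs => rw [← (B.lat.ofZLatticeBasis ℝ Λ).sum_repr v]
  simp [B.lat.ofZLatticeBasis_apply ℝ Λ, h1, h2, Matrix.diagonal_apply, mul_comm]

/-- By `bilin_eq_conj` the left side is `-2 ∑ ⟨w, a_i⟩ Im z_i` with `w = H(z, -)`, and `⟨w, a_i⟩ =
-E(z, a_i)` is `d_i` times the coordinate of `z` along `b_i`. -/
theorem HasType.re_bilin_toDual (hd : E.HasType B d) (v : V) (y : Fin g → ℝ)
    (hy : ∀ i, y i = (B.cplx.repr v i).im) :
    (B.bilin (E.toDual v) v).re - (E.toDual v v).re =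
      -2 * dotProduct y (((Matrix.diagonal fun i => (d i : ℝ)) *
            (B.periodMatrix.map Complex.im)⁻¹).mulVec y) := by
  have hy' : y = (B.periodMatrix.map Complex.im).mulVec
      fun j => (B.lat.ofZLatticeBasis ℝ Λ).repr v (Sum.inr j) :=
    (funext hy).trans (B.im_repr_eq v)
  have hp (i : Fin g) : pairing (E.toDual v) (B.a i) = -E.form v (B.a i) := by
    change (E.hermitian v (B.a i)).im = _
    simp [hermitian]
  have hq : (((Matrix.diagonal fun i => (d i : ℝ)) *
      (B.periodMatrix.map Complex.im)⁻¹).mulVec y) =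
      fun i => d i * (B.lat.ofZLatticeBasis ℝ Λ).repr v (Sum.inr i) := by
    rw [hy', Matrix.mulVec_mulVec, Matrix.mul_assoc,
      Matrix.nonsing_inv_mul _ B.isUnit_det_im_periodMatrix, mul_one]
    ext i
    rw [Matrix.mulVec_diagonal]
  rw [hq, B.bilin_eq_conj]
  simp [hp, hd.form_a, dotProduct, hy, mul_comm]

end Polarization
end PoincareBundle
end

open PoincareBundle in
theorem mainTheorem12 {V : Type*} [NormedAddCommGroup V] [NormedSpace ℂ V]
    [FiniteDimensional ℂ V] (Λ : Submodule ℤ V) [DiscreteTopology Λ] [IsZLattice ℝ Λ]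
    (E : Polarization Λ) {g : ℕ} (B : IntegralBasis Λ g) (d : Fin g → ℤ) (hd : E.HasType B d) :
    IsUnit (B.periodMatrix.map Complex.im).det ∧
    (∃! N : Poincare Λ → ℝ, IsInvariantMetric N) ∧
    (∃! e : V × AntiDual V → Poincare Λ, B.IsHolomorphicFrame e) ∧
    ∀ (N : Poincare Λ → ℝ) (_ : IsInvariantMetric N)
      (e : V × AntiDual V → Poincare Λ) (he : B.IsHolomorphicFrame e) (v : V) (s : ℂ)
      (y : Fin g → ℝ) (_ : ∀ i, y i = (B.cplx.repr v i).im),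
      Pullback.metric N (s • E.pullbackFrame he v) ^ 2 =
        ‖s‖ ^ 2 * Real.exp (-4 * Real.pi *
          dotProduct y (((Matrix.diagonal fun i => (d i : ℝ)) *
            (B.periodMatrix.map Complex.im)⁻¹).mulVec y)) := by
  refine ⟨B.isUnit_det_im_periodMatrix,
    ⟨invariantNorm Λ, B.isInvariantMetric_invariantNorm, fun N hN => B.eq_invariantNorm hN⟩,
    ⟨_, B.isHolomorphicFrame_frameCoeff, fun e he => he.eq_frameCoeff⟩, ?_⟩
  intro N hN e he v s y hy
  have hm : Pullback.metric N (s • E.pullbackFrame he v) = N (s • e (v, E.toDual v)) := rfl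
  rw [hm, B.eq_invariantNorm hN, he.eq_frameCoeff, Poincare.smul_mk, invariantNorm_mk, norm_mul,
    IntegralBasis.frameCoeff, Complex.norm_exp, mul_assoc, ← Real.exp_add, mul_pow,
    ← Real.exp_nat_mul]
  congr 2
  -- Squaring the norm doubles the exponent, so `-2` becomes `-4π`.
  have h := hd.re_bilin_toDual v y hy
  rw [Complex.re_ofReal_mul]
  push_cast
  linear_combination 2 * Real.pi * h
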